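/- Let $(K_0,v)$ be a valued field. Suppose that for every coarsening $w$ of $v$ (including $v$ itself) we are given a maximal immediate extension $(N_w|K_0,w)$, i.e. an immediate extension such that $(N_w,w)$ has no proper immediate extension, in which $K_0$ is relatively separable-algebraically closed (every element of $N_w$ that is separable-algebraic over $K_0$ lies in $K_0$). Let $(K|K_0,v)$ be a finite extension of valued fields which is defectless, i.e. $[K:K_0]=\sum_i (v_iK:v_iK_0)\,[Kv_i:K_0v_i]$, where $v_i$ runs over all extensions of $v|_{K_0}$ to $K$. Then for every coarsening $w$ of $v$ on $K_0$ (including $v$ itself) the following holds. There is a unique coarsening of the valuation $v$ of $K$ that extends $w$; denote it by $w$ again. Let $M_w=N_w.K$ be a compositum of $N_w$ and $K$, that is, a field containing $N_w$ and $K$ with the same subfield $K_0$ and generated by them. Then the valuation $w$ of $N_w$ has a unique extension to $M_w$, again denoted by $w$; with it, $(M_w,w)$ is a maximal immediate extension of $(K,w)$, and $K$ is relatively separable-algebraically closed in $M_w$. -/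

import Mathlib

namespace ValuedFieldExt

universe u v

section

variable {K : Type u} {L : Type v} [Field K] [Field L] [Algebra K L]

/-- A valuation of a field is given, up to equivalence, by its valuation ring.
`Extends V V'` says that the valuation of `L` with ring `V'` restricts to the valuation of `K` with
ring `V`, that is, `(L|K, V')` is an extension of valued fields. -/
def Extends (V : ValuationSubring K) (V' : ValuationSubring L) : Prop :=
  V'.comap (algebraMap K L) = V

theorem Extends.mem_iff {V : ValuationSubring K} {V' : ValuationSubring L} (h : Extends V V')
    (x : K) : algebraMap K L x ∈ V' ↔ x ∈ V := by
  rw [← h, ValuationSubring.mem_comap]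

/-- The inclusion of valuation rings of an extension of valued fields. -/
def Extends.ringMap {V : ValuationSubring K} {V' : ValuationSubring L} (h : Extends V V') :
    V →+* V' :=
  ((algebraMap K L).comp V.subtype).codRestrict V' fun x => (h.mem_iff x.1).2 x.2

theorem Extends.isLocalHom_ringMap {V : ValuationSubring K} {V' : ValuationSubring L}
    (h : Extends V V') : IsLocalHom h.ringMap := by
  refine ⟨fun x hx => ?_⟩
  obtain ⟨y, hy⟩ := hx.exists_right_inv
  have hy' : algebraMap K L x.1 * y.1 = 1 := congrArg Subtype.val hy
  have hx0 : (x : K) ≠ 0 := by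
    rintro h0
    rw [h0] at hy'
    simp at hy'
  have hmem : (x : K)⁻¹ ∈ V := by
    rw [← h.mem_iff, map_inv₀, inv_eq_of_mul_eq_one_right hy']
    exact y.2
  exact IsUnit.of_mul_eq_one ⟨(x : K)⁻¹, hmem⟩ (Subtype.ext (mul_inv_cancel₀ hx0))

/-- The embedding of residue fields `Kv → Lv` of an extension of valued fields. -/
noncomputable def Extends.residueMap {V : ValuationSubring K} {V' : ValuationSubring L}
    (h : Extends V V') : IsLocalRing.ResidueField V →+* IsLocalRing.ResidueField V' :=
  haveI := h.isLocalHom_ringMap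
  IsLocalRing.ResidueField.map h.ringMap

/-- The inertia degree `[Lv : Kv]`. -/
noncomputable def Extends.inertiaDegree {V : ValuationSubring K} {V' : ValuationSubring L}
    (h : Extends V V') : ℕ :=
  letI := h.residueMap.toAlgebra
  Module.finrank (IsLocalRing.ResidueField V) (IsLocalRing.ResidueField V')

variable (K) in
/-- The value group of `K`, as a subgroup of the value group `vL` of the valuation with
ring `V'` on `L`. -/
noncomputable def valueSubgroup (V' : ValuationSubring L) : Subgroup V'.ValueGroupˣ :=
  (Units.map ((V'.valuation : L →* V'.ValueGroup).comp (algebraMap K L : K →* L))).range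

variable (K) in
/-- The ramification index `(vL : vK)`. -/
noncomputable def ramificationIndex (V' : ValuationSubring L) : ℕ :=
  (valueSubgroup K V').index

/-- A finite extension `L|K` is defectless with respect to the valuation of `K` with ring `V` if
the fundamental equality `[L : K] = ∑ eᵢ fᵢ` holds, where the sum is over all extensions of the
valuation from `K` to `L`. -/
def IsDefectless (L : Type v) [Field L] [Algebra K L] (V : ValuationSubring K) : Prop :=
  FiniteDimensional K L ∧
    Module.finrank K L =
      ∑ᶠ V' : {V' : ValuationSubring L // Extends V V'},
        ramificationIndex K V'.1 * V'.2.inertiaDegree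

/-- An extension of valued fields is immediate if the embeddings `vK → vL` and `Kv → Lv` are
onto. -/
def IsImmediate (V : ValuationSubring K) (V' : ValuationSubring L) : Prop :=
  ∃ h : Extends V V', valueSubgroup K V' = ⊤ ∧ Function.Surjective h.residueMap

end

/-- A valued field is maximal if it has no proper immediate extension. (Every proper immediate
extension contains one that is generated by a single element, so the restriction to one universe
is harmless.) -/
def IsMaximal {K : Type u} [Field K] (V : ValuationSubring K) : Prop :=
  ∀ (F : Type u) [Field F] [Algebra K F] (V' : ValuationSubring F),
    IsImmediate V V' → Function.Surjective (algebraMap K F)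

/-- `(L|K, V')` is a maximal immediate extension of `(K, V)`. -/
def IsMaximalImmediate {K : Type u} {L : Type v} [Field K] [Field L] [Algebra K L]
    (V : ValuationSubring K) (V' : ValuationSubring L) : Prop :=
  IsImmediate V V' ∧ IsMaximal V'

/-- `K` is relatively separable-algebraically closed in `F`: every element of `F` that is
separable-algebraic over `K` lies in `K`. -/
def IsRelSepClosed (K : Type u) (F : Type v) [Field K] [Field F] [Algebra K F] : Prop :=
  separableClosure K F = ⊥

end ValuedFieldExt

/-!
A valued field is maximal if and only if it is spherically complete. If a chain of balls in `K` has
empty intersection, then some ultrapower of `K` contains a point of all of them, which `K`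
approximates without a best approximation, and this produces a proper immediate extension of `K`.
Conversely, a new element of an immediate extension has no best approximation in `K`.

Spherical completeness passes to finite extensions, so `M_w = N_w.K` is maximal. It also gives
Hensel's lemma, and hence the uniqueness of the extensions of the valuation of `N_w` to algebraic
extensions. Since `K₀` is relatively separable-algebraically closed in `N_w`, elements separable
over `K₀` have the same minimal polynomial over `K₀` and over `N_w`, so `w` has a unique extension
to `K` too. For `w = v` this turns defectlessness into `[K : K₀] = e f`, so that `K` has a
valuation basis over `K₀`. It remains a valuation basis for every coarsening. Approximating in `K₀`
the coefficients in `N_w` of an element of `M_w` with respect to this basis, one obtains an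
approximation in `K`, so `M_w|K` is immediate. Finally, `K` is relatively separable-algebraically
closed in `M_w` by a comparison of separable degrees.
-/

namespace ValuedFieldExt

open Polynomial

universe u v

section SphericallyComplete

/-- An `R`-module is spherically complete if every chain of cosets of submodules has a common
point. For the module of a valued field over its valuation ring the submodules are the balls around
`0`, so that this is spherical completeness in the usual sense. -/
def IsSphericallyComplete (R E : Type*) [Ring R] [AddCommGroup E] [Module R E] : Prop :=
  ∀ S : Set (Set E), (∀ B ∈ S, ∃ (c : E) (I : Submodule R E), ∀ x, x ∈ B ↔ x - c ∈ I) →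
    IsChain (· ⊆ ·) S → (⋂₀ S).Nonempty

namespace IsSphericallyComplete

variable {R E : Type*} [Ring R] [AddCommGroup E] [Module R E]

theorem of_surjective {R' E' : Type*} [Ring R'] [AddCommGroup E'] [Module R' E'] {σ : R →+* R'}
    (φ : E →ₛₗ[σ] E') (hφ : Function.Surjective φ) (h : IsSphericallyComplete R E) :
    IsSphericallyComplete R' E' := by
  intro S hS hc
  obtain ⟨x, hx⟩ := h ((φ ⁻¹' ·) '' S) (by
      rintro _ ⟨B, hB, rfl⟩
      obtain ⟨c, I, hI⟩ := hS B hB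
      obtain ⟨c, rfl⟩ := hφ c
      exact ⟨c, I.comap φ, by simp [hI]⟩)
    (hc.image_of_map_rel _ _ _ fun _ _ h => Set.preimage_mono h)
  exact ⟨φ x, fun B hB => hx _ ⟨B, hB, rfl⟩⟩

variable {E' : Type*} [AddCommGroup E'] [Module R E']

theorem mem_image_iff_sub_mem_map (φ : E →ₗ[R] E') {B : Set E} {c : E}
    {I : Submodule R E} (hI : ∀ x, x ∈ B ↔ x - c ∈ I) (y : E') :
    y ∈ φ '' B ↔ y - φ c ∈ I.map φ := by
  constructor
  · rintro ⟨x, hx, rfl⟩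
    exact ⟨x - c, (hI x).1 hx, map_sub ..⟩
  · rintro ⟨x, hx, hxy⟩
    exact ⟨x + c, (hI _).2 (by simpa using hx), by rw [map_add, hxy, sub_add_cancel]⟩

theorem of_injective (φ : E →ₗ[R] E') (hφ : Function.Injective φ)
    (h : IsSphericallyComplete R E') : IsSphericallyComplete R E := by
  intro S hS hc
  obtain rfl | ⟨B₀, hB₀⟩ := S.eq_empty_or_nonempty
  · exact ⟨0, by simp⟩
  obtain ⟨y, hy⟩ := h ((φ '' ·) '' S) (by
      rintro _ ⟨B, hB, rfl⟩
      obtain ⟨c, I, hI⟩ := hS B hB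
      exact ⟨φ c, I.map φ, mem_image_iff_sub_mem_map φ hI⟩)
    (hc.image_of_map_rel _ _ _ fun _ _ h => Set.image_mono h)
  obtain ⟨x, -, rfl⟩ := hy _ ⟨B₀, hB₀, rfl⟩
  exact ⟨x, fun B hB => hφ.mem_set_image.1 (hy _ ⟨B, hB, rfl⟩)⟩

theorem prod (h : IsSphericallyComplete R E) (h' : IsSphericallyComplete R E') :
    IsSphericallyComplete R (E × E') := by
  intro S hS hc
  obtain ⟨b, hb⟩ := h' ((LinearMap.snd R E E' '' ·) '' S) (by
      rintro _ ⟨B, hB, rfl⟩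
      obtain ⟨c, I, hI⟩ := hS B hB
      exact ⟨_, _, mem_image_iff_sub_mem_map (LinearMap.snd R E E') hI⟩)
    (hc.image_of_map_rel _ _ _ fun _ _ h => Set.image_mono h)
  obtain ⟨a, ha⟩ := h ((((·, b) : E → E × E') ⁻¹' ·) '' S) (by
      rintro _ ⟨B, hB, rfl⟩
      obtain ⟨⟨a₀, _⟩, ha₀, rfl⟩ := hb _ ⟨B, hB, rfl⟩
      obtain ⟨c, I, hI⟩ := hS B hB
      refine ⟨a₀, I.comap (LinearMap.inl R E E'), fun a => ?_⟩
      rw [hI] at ha₀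
      rw [Set.mem_preimage, hI, ← I.sub_mem_iff_left ha₀]
      simp)
    (hc.image_of_map_rel _ _ _ fun _ _ h => Set.preimage_mono h)
  exact ⟨(a, b), fun B hB => ha _ ⟨B, hB, rfl⟩⟩

theorem pi_fin (h : IsSphericallyComplete R E) (n : ℕ) :
    IsSphericallyComplete R (Fin n → E) := by
  induction n with
  | zero =>
    refine fun S hS _ => ⟨0, fun B hB => ?_⟩
    obtain ⟨c, I, hI⟩ := hS B hB
    rw [hI, Subsingleton.elim (0 - c) 0]
    exact I.zero_mem
  | succ n ih =>
    exact (h.prod ih).of_surjective (Fin.consLinearEquiv R fun _ : Fin (n + 1) => E).toLinearMap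
      (LinearEquiv.surjective _)

theorem of_finite (A : Type*) [Ring A] [Module R A] [Module A E] [IsScalarTower R A A]
    [IsScalarTower R A E] [Module.Finite A E] (h : IsSphericallyComplete R A) :
    IsSphericallyComplete R E := by
  obtain ⟨n, f, hf⟩ := Module.Finite.exists_fin' A E
  exact (h.pi_fin n).of_surjective (f.restrictScalars R) hf

end IsSphericallyComplete

theorem IsSphericallyComplete.subring_of_finite {K L : Type*} [Field K] [Field L] [Algebra K L]
    [FiniteDimensional K L] {V : ValuationSubring K} (h : IsSphericallyComplete V K)
    {A : Subring L} (hA : ∀ x ∈ V, algebraMap K L x ∈ A) : IsSphericallyComplete A L := by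
  let σ : V →+* A := ((algebraMap K L).comp V.subtype).codRestrict A fun x => hA x x.2
  let φ : L →ₛₗ[σ] L := { AddMonoidHom.id L with
    map_smul' := fun c x => Algebra.smul_def (c : K) x }
  exact (h.of_finite (E := L) K).of_surjective φ Function.surjective_id

end SphericallyComplete

section Approximation

variable {R Γ : Type*} [Ring R] [LinearOrderedCommGroupWithZero Γ] {v : Valuation R Γ}

/-- `y` approximates `z` to first order: `z` and `y` have the same value and, in a field, `y / z` is
a principal unit. -/
def Approximates (v : Valuation R Γ) (y z : R) : Prop := v (z - y) < v z

theorem Approximates.valuation_eq {y z : R} (h : Approximates v y z) : v y = v z := by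
  simpa using v.map_sub_eq_of_lt_right h

theorem Approximates.mul {y z y' z' : R} (h : Approximates v y z) (h' : Approximates v y' z') :
    Approximates v (y * y') (z * z') := by
  have hz : 0 < v z := zero_le.trans_lt h
  have hz' : 0 < v z' := zero_le.trans_lt h'
  rw [Approximates, show z * z' - y * y' = z * (z' - y') + (z - y) * y' by noncomm_ring]
  refine (v.map_add _ _).trans_lt (max_lt ?_ ?_)
  · rw [map_mul, map_mul]
    exact mul_lt_mul_of_pos_left h' hz
  · rw [map_mul, map_mul, h'.valuation_eq]
    exact mul_lt_mul_of_pos_right h hz'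

theorem Approximates.inv {F : Type*} [Field F] {v : Valuation F Γ} {y z : F}
    (h : Approximates v y z) : Approximates v y⁻¹ z⁻¹ := by
  have hz : z ≠ 0 := v.ne_zero_iff.1 (zero_le.trans_lt h).ne'
  have hy : y ≠ 0 := v.ne_zero_iff.1 (h.valuation_eq ▸ (zero_le.trans_lt h).ne')
  rw [Approximates, show z⁻¹ - y⁻¹ = -(z⁻¹ * y⁻¹ * (z - y)) by field_simp; ring, v.map_neg,
    map_mul, map_mul, map_inv₀, map_inv₀, h.valuation_eq]
  have hv : v z ≠ 0 := v.ne_zero_iff.2 hz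
  calc (v z)⁻¹ * (v z)⁻¹ * v (z - y) < (v z)⁻¹ * (v z)⁻¹ * v z :=
        mul_lt_mul_of_pos_left h (by simpa [zero_lt_iff])
    _ = (v z)⁻¹ := by rw [mul_assoc, inv_mul_cancel₀ hv, mul_one]

theorem Approximates.multiset_prod {F ι : Type*} [CommRing F] {v : Valuation F Γ}
    {s : Multiset ι} {f g : ι → F} (h : ∀ i ∈ s, Approximates v (f i) (g i)) :
    Approximates v (s.map f).prod (s.map g).prod := by
  induction s using Multiset.induction with
  | empty => simp [Approximates]
  | cons i s ih =>
    rw [Multiset.map_cons, Multiset.map_cons, Multiset.prod_cons, Multiset.prod_cons]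
    exact (h i (Multiset.mem_cons_self i s)).mul
      (ih fun j hj => h j (Multiset.mem_cons_of_mem hj))

theorem Approximates.sum {ι : Type*} [Fintype ι] {f g : ι → R}
    (hfg : ∀ i, f i = g i ∨ Approximates v (f i) (g i)) (hf : ∀ i, v (f i) ≤ v (∑ j, f j))
    (hg : v (∑ i, g i) ≠ 0) : Approximates v (∑ i, f i) (∑ i, g i) := by
  have hf0 : v (∑ i, f i) ≠ 0 := by
    intro h0
    have heq (i : ι) : f i = g i := (hfg i).resolve_right fun h =>
      (zero_le.trans_lt h).not_ge (h.valuation_eq ▸ (hf i).trans h0.le)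
    exact hg (by simpa only [heq] using h0)
  have hlt : v (∑ i, f i - ∑ i, g i) < v (∑ i, f i) := by
    rw [← Finset.sum_sub_distrib]
    refine v.map_sum_lt hf0 fun i _ => ?_
    obtain h | h := hfg i
    · rw [h, sub_self, map_zero]
      exact zero_lt_iff.2 hf0
    · rw [v.map_sub_swap]
      exact h.trans_le (h.valuation_eq ▸ hf i)
  have heq : v (∑ i, g i) = v (∑ i, f i) := Approximates.valuation_eq hlt
  rwa [Approximates, heq, v.map_sub_swap]

end Approximation

section Immediate

variable {K : Type u} {L : Type v} [Field K] [Field L] [Algebra K L]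
  {V : ValuationSubring K} {V' : ValuationSubring L}

theorem Extends.valuation_le_iff (h : Extends V V') (x y : K) :
    V'.valuation (algebraMap K L x) ≤ V'.valuation (algebraMap K L y) ↔
      V.valuation x ≤ V.valuation y := by
  obtain rfl | hy := eq_or_ne y 0
  · simp
  have hVy : 0 < V.valuation y := by simpa [zero_lt_iff]
  have hV'y : 0 < V'.valuation (algebraMap K L y) := by simpa [zero_lt_iff]
  rw [← div_le_one₀ hVy, ← div_le_one₀ hV'y, ← map_div₀, ← map_div₀, ← map_div₀,
    V.valuation_le_one_iff, V'.valuation_le_one_iff, h.mem_iff]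

theorem Extends.valuation_lt_iff (h : Extends V V') (x y : K) :
    V'.valuation (algebraMap K L x) < V'.valuation (algebraMap K L y) ↔
      V.valuation x < V.valuation y := by
  rw [← not_le, ← not_le, h.valuation_le_iff]

theorem residue_eq_iff (x y : V) :
    IsLocalRing.residue V x = IsLocalRing.residue V y ↔ V.valuation (x - y : K) < 1 := by
  rw [← sub_eq_zero, ← map_sub, IsLocalRing.residue_eq_zero_iff, V.valuation_lt_one_iff,
    AddSubgroupClass.coe_sub]

theorem IsImmediate.exists_approximates (h : IsImmediate V V') {z : L} (hz : z ≠ 0) :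
    ∃ a : K, Approximates V'.valuation (algebraMap K L a) z := by
  obtain ⟨hE, hv, hr⟩ := h
  obtain ⟨c, hc⟩ : Units.map (V'.valuation : L →* V'.ValueGroup) (Units.mk0 z hz) ∈
    valueSubgroup K V' := hv ▸ Subgroup.mem_top _
  have hcz : V'.valuation (algebraMap K L c) = V'.valuation z := congrArg Units.val hc
  have hc0 : algebraMap K L c ≠ 0 := by simp
  have hmem : z / algebraMap K L c ∈ V' := by
    rw [← V'.valuation_le_one_iff, map_div₀, hcz, div_self (by simpa using hz)]
  obtain ⟨r, hr⟩ := hr (IsLocalRing.residue V' ⟨_, hmem⟩)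
  obtain ⟨a, rfl⟩ := IsLocalRing.residue_surjective r
  have ha : V'.valuation (z / algebraMap K L c - algebraMap K L a) < 1 :=
    (residue_eq_iff ⟨_, hmem⟩ (hE.ringMap a)).1 hr.symm
  refine ⟨c * a, ?_⟩
  calc V'.valuation (z - algebraMap K L (c * a)) = V'.valuation (algebraMap K L c) *
        V'.valuation (z / algebraMap K L c - algebraMap K L a) := by
        rw [← map_mul, mul_sub, mul_div_cancel₀ _ hc0, map_mul]
    _ < V'.valuation (algebraMap K L c) :=
        mul_lt_of_lt_one_right (by simp [zero_lt_iff]) ha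
    _ = V'.valuation z := hcz

theorem isImmediate_of_exists_approximates (h : Extends V V')
    (H : ∀ z : L, z ≠ 0 → ∃ a : K, Approximates V'.valuation (algebraMap K L a) z) :
    IsImmediate V V' := by
  refine ⟨h, eq_top_iff.2 fun γ _ => ?_, fun r => ?_⟩
  · obtain ⟨z, hz⟩ := V'.valuation_surjective γ
    have hz0 : z ≠ 0 := V'.valuation.ne_zero_iff.1 (hz ▸ γ.ne_zero)
    obtain ⟨a, ha⟩ := H z hz0
    have ha0 : a ≠ 0 := by
      rintro rfl
      simp [Approximates] at ha
    exact ⟨Units.mk0 a ha0, Units.ext (ha.valuation_eq.trans hz)⟩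
  · obtain ⟨z, rfl⟩ := IsLocalRing.residue_surjective r
    obtain hz | hz := eq_or_ne (z : L) 0
    · exact ⟨0, by rw [map_zero, show z = 0 from Subtype.ext hz, map_zero]⟩
    obtain ⟨a, ha⟩ := H z hz
    have haV : a ∈ V := by
      rw [← h.mem_iff, ← V'.valuation_le_one_iff, ha.valuation_eq]
      exact V'.valuation_le_one z
    exact ⟨IsLocalRing.residue V ⟨a, haV⟩,
      ((residue_eq_iff z (h.ringMap ⟨a, haV⟩)).2 (ha.trans_le (V'.valuation_le_one z))).symm⟩

end Immediate

section BestApproximation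

variable {K : Type u} {L : Type v} [Field K] [Field L] [Algebra K L]

/-- The elements of `K` approximate `x` better and better without a best approximation, as for a
pseudo-limit of a pseudo-Cauchy family of `K` that has no pseudo-limit in `K`. -/
def HasNoBestApprox (K : Type*) {L Γ : Type*} [Field K] [Field L] [Algebra K L]
    [LinearOrderedCommGroupWithZero Γ] (v : Valuation L Γ) (x : L) : Prop :=
  ∀ a : K, ∃ b : K, v (x - algebraMap K L b) < v (x - algebraMap K L a)

section

variable {Γ : Type*} [LinearOrderedCommGroupWithZero Γ] {v : Valuation L Γ} {x : L}

theorem HasNoBestApprox.notMem_range (hx : HasNoBestApprox K v x) :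
    x ∉ Set.range (algebraMap K L) := by
  rintro ⟨a, rfl⟩
  obtain ⟨b, hb⟩ := hx a
  simp at hb

theorem HasNoBestApprox.of_forall_sub_lt {y : L} (hx : HasNoBestApprox K v x)
    (hxy : ∀ a : K, v (x - y) < v (x - algebraMap K L a)) : HasNoBestApprox K v y := by
  have hval (a : K) : v (y - algebraMap K L a) = v (x - algebraMap K L a) := by
    rw [← v.map_sub_eq_of_lt_right (hxy a), sub_sub_sub_cancel_left, v.map_sub_swap]
  simpa only [HasNoBestApprox, hval] using hx

theorem HasNoBestApprox.exists_forall_sub_lt (hx : HasNoBestApprox K v x) (s : Finset L)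
    (hs : ∀ y ∈ s, ¬ HasNoBestApprox K v y) :
    ∃ b : K, ∀ y ∈ s, v (x - algebraMap K L b) < v (x - y) := by
  classical
  induction s using Finset.induction_on with
  | empty => exact ⟨0, by simp⟩
  | insert y s _ ih =>
    rw [Finset.forall_mem_insert] at hs
    obtain ⟨b, hb⟩ := ih hs.2
    obtain ⟨a, ha⟩ : ∃ a : K, v (x - algebraMap K L a) ≤ v (x - y) := by
      by_contra! h
      exact hs.1 (hx.of_forall_sub_lt h)
    obtain ⟨c, hc⟩ := hx a
    simp only [Finset.forall_mem_insert]
    obtain h | h := le_total (v (x - algebraMap K L b)) (v (x - algebraMap K L c))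
    · exact ⟨b, h.trans_lt (hc.trans_le ha), hb⟩
    · exact ⟨c, hc.trans_le ha, fun z hz => h.trans_lt (hb z hz)⟩

theorem HasNoBestApprox.exists_approximates_aeval [IsAlgClosed L] (hx : HasNoBestApprox K v x)
    {f : K[X]} (hf : ∀ y, aeval y f = 0 → ¬ HasNoBestApprox K v y) :
    ∃ a : K, Approximates v (algebraMap K L a) (aeval x f) := by
  classical
  have hf0 : f ≠ 0 := by
    rintro rfl
    exact hf x (map_zero _) hx
  have hroots : ∀ y ∈ f.aroots L, ¬ HasNoBestApprox K v y := fun y hy => hf y (mem_aroots.1 hy).2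
  obtain ⟨b, hb⟩ := hx.exists_forall_sub_lt (f.aroots L).toFinset
    (by simpa only [Multiset.mem_toFinset] using hroots)
  have heval (z : L) : aeval z f =
      algebraMap K L f.leadingCoeff * ((f.aroots L).map (z - ·)).prod := by
    simpa using (IsAlgClosed.splits (f.map (algebraMap K L))).eval_eq_prod_roots z
  refine ⟨f.eval b, ?_⟩
  rw [← aeval_algebraMap_apply_eq_algebraMap_eval, heval, heval]
  refine Approximates.mul ?_ (Approximates.multiset_prod fun y hy => ?_)
  · simpa [Approximates, zero_lt_iff] using hf0
  · simpa [Approximates] using hb y (Multiset.mem_toFinset.2 hy)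

theorem HasNoBestApprox.exists_forall_aeval (hx : HasNoBestApprox K v x) :
    ∃ y, HasNoBestApprox K v y ∧ ∀ f : K[X], aeval y f ≠ 0 →
      ∃ g : K[X], aeval y g = aeval y f ∧ ∀ z, aeval z g = 0 → ¬ HasNoBestApprox K v z := by
  by_cases h : ∃ p : K[X], p ≠ 0 ∧ ∃ y, aeval y p = 0 ∧ HasNoBestApprox K v y
  · obtain ⟨p, ⟨hp0, y, hpy, hy⟩, hmin⟩ := exists_minimalFor_of_wellFoundedLT _ degree h
    refine ⟨y, hy, fun f hf => ⟨f % p, ?_, fun z hz hzx => ?_⟩⟩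
    · conv_rhs => rw [← EuclideanDomain.mod_add_div f p, map_add, map_mul, hpy, zero_mul, add_zero]
    · have hmod : f % p = 0 := by
        by_contra hmod
        exact (degree_mod_lt f hp0).not_ge (hmin ⟨hmod, z, hz, hzx⟩ (degree_mod_lt f hp0).le)
      rw [← EuclideanDomain.mod_add_div f p, hmod, map_add, map_mul, hpy] at hf
      simp at hf
  · push Not at h
    exact ⟨x, hx, fun f hf => ⟨f, rfl, fun z hz => h f (fun h0 => hf (by simp [h0])) z hz⟩⟩

end

section

variable {V : ValuationSubring K} {V' : ValuationSubring L}

theorem HasNoBestApprox.exists_isImmediate_adjoin [IsAlgClosed L] (h : Extends V V') {x : L}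
    (hx : HasNoBestApprox K V'.valuation x) :
    ∃ y : L, HasNoBestApprox K V'.valuation y ∧
      IsImmediate V (V'.comap (algebraMap (IntermediateField.adjoin K {y}) L)) := by
  obtain ⟨y, hy, hfg⟩ := hx.exists_forall_aeval
  have haeval (f : K[X]) (hf : aeval y f ≠ 0) :
      ∃ a : K, Approximates V'.valuation (algebraMap K L a) (aeval y f) := by
    obtain ⟨g, hgf, hg⟩ := hfg f hf
    exact hgf ▸ hy.exists_approximates_aeval hg
  let F := IntermediateField.adjoin K {y}
  have hF : Extends (V'.comap (algebraMap F L)) V' := rfl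
  refine ⟨y, hy, isImmediate_of_exists_approximates h fun z hz => ?_⟩
  obtain ⟨r, s, hrs⟩ := IntermediateField.mem_adjoin_simple_iff K (z : L) |>.1 z.2
  have hz' : (z : L) ≠ 0 := by simpa using hz
  rw [hrs, div_ne_zero_iff] at hz'
  obtain ⟨a, ha⟩ := haeval r hz'.1
  obtain ⟨b, hb⟩ := haeval s hz'.2
  refine ⟨a * b⁻¹, (hF.valuation_lt_iff _ _).1 ?_⟩
  have := ha.mul hb.inv
  rw [← div_eq_mul_inv (aeval y r), ← hrs] at this
  simpa [Approximates] using this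

theorem IsImmediate.hasNoBestApprox (h : IsImmediate V V') {x : L}
    (hx : x ∉ Set.range (algebraMap K L)) : HasNoBestApprox K V'.valuation x := by
  intro a
  obtain ⟨b, hb⟩ := h.exists_approximates (z := x - algebraMap K L a)
    fun h0 => hx ⟨a, (sub_eq_zero.1 h0).symm⟩
  exact ⟨a + b, by rwa [map_add, ← sub_sub]⟩

theorem IsSphericallyComplete.not_hasNoBestApprox (hV : IsSphericallyComplete V K)
    (h : Extends V V') (x : L) : ¬ HasNoBestApprox K V'.valuation x := by
  intro hx
  let v := V'.valuation
  let ball (a : K) : Submodule V K :=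
    { carrier := {y | v (algebraMap K L y) ≤ v (x - algebraMap K L a)}
      add_mem' := fun hy hz => by
        simpa only [Set.mem_ofPred_eq, map_add] using v.map_add_le hy hz
      zero_mem' := by simp
      smul_mem' := fun c y hy => by
        have hc : v (algebraMap K L c) ≤ 1 := (V'.valuation_le_one_iff _).2 ((h.mem_iff _).2 c.2)
        simpa only [Set.mem_ofPred_eq, Algebra.smul_def, map_mul] using!
          (mul_le_of_le_one_left' hc).trans hy }
  have mem_ball (a y : K) :
      y - a ∈ ball a ↔ v (x - algebraMap K L y) ≤ v (x - algebraMap K L a) := by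
    have hdef : y - a ∈ ball a ↔ v (algebraMap K L (y - a)) ≤ v (x - algebraMap K L a) := Iff.rfl
    rw [hdef, map_sub, ← sub_sub_sub_cancel_left _ _ x]
    refine ⟨fun h => ?_, v.map_sub_le le_rfl⟩
    simpa using v.map_sub_le le_rfl h
  obtain ⟨a, ha⟩ := hV (Set.range fun a => {y | y - a ∈ ball a})
    (by rintro _ ⟨a, rfl⟩; exact ⟨a, ball a, fun _ => Iff.rfl⟩) (by
      rintro _ ⟨a, rfl⟩ _ ⟨b, rfl⟩ -
      simp only [mem_ball, Set.ofPred_subset_ofPred]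
      exact (le_total (v (x - algebraMap K L a)) (v (x - algebraMap K L b))).imp
        (fun h _ hy => hy.trans h) (fun h _ hy => hy.trans h))
  obtain ⟨b, hb⟩ := hx a
  exact hb.not_ge ((mem_ball b a).1 (ha _ ⟨b, rfl⟩))

end

theorem IsSphericallyComplete.isMaximal {V : ValuationSubring K} (hV : IsSphericallyComplete V K) :
    IsMaximal V := fun _ _ _ _ h x => by
  by_contra hx
  exact hV.not_hasNoBestApprox h.1 x (h.hasNoBestApprox hx)

end BestApproximation

section Ultrapower

variable {K : Type u} [Field K]

theorem exists_extends (V : ValuationSubring K) (L : Type v) [Field L] [Algebra K L] :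
    ∃ V' : ValuationSubring L, Extends V V' := by
  obtain ⟨V', hV', hloc⟩ :=
    IsLocalRing.exists_factor_valuationRing ((algebraMap K L).comp V.subtype)
  refine ⟨V', ValuationSubring.ext _ _ fun x => ⟨fun hx => ?_, fun hx => hV' ⟨x, hx⟩⟩⟩
  by_contra hxV
  have hx0 : x ≠ 0 := fun h => hxV (h ▸ V.zero_mem)
  have hinv : x⁻¹ ∈ V := (V.mem_or_inv_mem x).resolve_left hxV
  have hu : IsUnit (⟨x⁻¹, hinv⟩ : V) := hloc.map_nonunit _ <|
    IsUnit.of_mul_eq_one ⟨algebraMap K L x, hx⟩ <| Subtype.ext <| by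
      change algebraMap K L x⁻¹ * algebraMap K L x = 1
      rw [← map_mul, inv_mul_cancel₀ hx0, map_one]
  rw [V.valuation_eq_one_iff, map_inv₀, inv_eq_one] at hu
  exact hxV ((V.valuation_le_one_iff x).1 hu.le)

theorem Extends.trans {L F : Type*} [Field L] [Field F] [Algebra K L] [Algebra K F] [Algebra L F]
    [IsScalarTower K L F] {V : ValuationSubring K} {V' : ValuationSubring L}
    {V'' : ValuationSubring F} (h : Extends V V') (h' : Extends V' V'') : Extends V V'' := by
  rw [Extends, ← h, ← h', ValuationSubring.comap_comap, ← IsScalarTower.algebraMap_eq]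

theorem HasNoBestApprox.algebraMap {L F : Type*} [Field L] [Field F] [Algebra K L] [Algebra K F]
    [Algebra L F] [IsScalarTower K L F] {V' : ValuationSubring L} {V'' : ValuationSubring F}
    (h : Extends V' V'') {x : L} (hx : HasNoBestApprox K V'.valuation x) :
    HasNoBestApprox K V''.valuation (algebraMap L F x) := by
  simpa only [HasNoBestApprox, IsScalarTower.algebraMap_apply K L F, ← map_sub,
    h.valuation_lt_iff] using hx

/-- The valuation ring of an ultrapower of a valued field. -/
def ultrapower {ι : Type*} (φ : Ultrafilter ι) (V : ValuationSubring K) :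
    ValuationSubring (Filter.Germ (φ : Filter ι) K) where
  carrier := {x | Filter.Germ.LiftPred (· ∈ V) x}
  mul_mem' {x y} := by
    induction x using Filter.Germ.inductionOn
    induction y using Filter.Germ.inductionOn
    exact fun hx hy => (hx.and hy).mono fun i h => V.mul_mem _ _ h.1 h.2
  one_mem' := Filter.Eventually.of_forall fun _ => V.one_mem
  add_mem' {x y} := by
    induction x using Filter.Germ.inductionOn
    induction y using Filter.Germ.inductionOn
    exact fun hx hy => (hx.and hy).mono fun i h => V.add_mem _ _ h.1 h.2
  zero_mem' := Filter.Eventually.of_forall fun _ => V.zero_mem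
  neg_mem' {x} := by
    induction x using Filter.Germ.inductionOn
    exact fun hx => hx.mono fun i h => V.neg_mem _ h
  mem_or_inv_mem' x := by
    induction x using Filter.Germ.inductionOn with | _ f
    exact φ.eventually_or.1 (Filter.Eventually.of_forall fun i => V.mem_or_inv_mem (f i))

theorem ultrapower_valuation_lt {ι : Type*} {φ : Ultrafilter ι} {V : ValuationSubring K}
    {f g : ι → K} (h : ∀ᶠ i in φ, V.valuation (f i) < V.valuation (g i)) :
    (ultrapower φ V).valuation (f : Filter.Germ (φ : Filter ι) K) <
      (ultrapower φ V).valuation (g : Filter.Germ (φ : Filter ι) K) := by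
  rw [← not_le, ValuationSubring.valuation_le_iff]
  rintro ⟨⟨c, hc⟩, hcf⟩
  induction c using Filter.Germ.inductionOn with | _ c
  obtain ⟨i, hi, hci, hcfi⟩ := (h.and (Filter.Eventually.and hc (Filter.Germ.coe_eq.1 hcf))).exists
  refine hi.not_ge ((V.valuation_le_iff _ _).2 ⟨⟨c i, hci⟩, hcfi⟩)

open Filter in
theorem exists_hasNoBestApprox {V : ValuationSubring K} (hV : ¬ IsSphericallyComplete V K) :
    ∃ (F : Type u) (_ : Field F) (_ : Algebra K F) (V' : ValuationSubring F) (x : F),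
      Extends V V' ∧ HasNoBestApprox K V'.valuation x := by
  simp only [IsSphericallyComplete, not_forall, Set.not_nonempty_iff_eq_empty] at hV
  obtain ⟨S, hS, hc, hempty⟩ := hV
  -- the class of `id` lies in every ball of the chain, in the ultrapower for an ultrafilter on `K`
  -- that contains the chain
  have hne : ∀ B ∈ S, B.Nonempty := fun B hB => by
    obtain ⟨c, I, hI⟩ := hS B hB
    exact ⟨c, by simp [hI]⟩
  have hdir : Directed (· ≥ ·) fun B : S => 𝓟 (B : Set K) := fun B C =>
    (hc.total B.2 C.2).elim (fun h => ⟨B, le_rfl, principal_mono.2 h⟩)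
      fun h => ⟨C, principal_mono.2 h, le_rfl⟩
  have : (⨅ B : S, 𝓟 (B : Set K)).NeBot :=
    iInf_neBot_of_directed hdir fun B => principal_neBot_iff.2 (hne B B.2)
  let φ := Ultrafilter.of (⨅ B : S, 𝓟 (B : Set K))
  have hφ {B : Set K} (hB : B ∈ S) : B ∈ φ :=
    Ultrafilter.of_le _ (mem_iInf_of_mem ⟨B, hB⟩ (mem_principal_self B))
  let _ : Algebra K (Germ (φ : Filter K) K) :=
    ((Germ.coeRingHom (φ : Filter K)).comp (Pi.constRingHom K K)).toAlgebra
  refine ⟨Germ (φ : Filter K) K, inferInstance, inferInstance, ultrapower φ V,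
    ((id : K → K) : Germ (φ : Filter K) K),
    ValuationSubring.ext _ _ fun a => eventually_const (f := (φ : Filter K)) (p := a ∈ V),
    fun a => ?_⟩
  obtain ⟨B, hB, haB⟩ : ∃ B ∈ S, a ∉ B := by
    have := hempty.symm ▸ Set.notMem_empty a
    simpa using this
  obtain ⟨c, I, hI⟩ := hS B hB
  refine ⟨c, ultrapower_valuation_lt (mem_of_superset (hφ hB) fun y hy => ?_)⟩
  rw [Set.mem_ofPred_eq, ← not_le, V.valuation_le_iff]
  rintro ⟨r, hr⟩
  have hya : y - a ∈ I := (show r • (y - c) = y - a from hr) ▸ I.smul_mem r ((hI y).1 hy)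
  rw [hI, ← sub_sub_sub_cancel_left _ _ y] at haB
  exact haB (I.sub_mem ((hI y).1 hy) hya)

theorem IsMaximal.isSphericallyComplete {V : ValuationSubring K} (hV : IsMaximal V) :
    IsSphericallyComplete V K := by
  by_contra hsc
  obtain ⟨F, _, _, V', x, hV', hx⟩ := exists_hasNoBestApprox hsc
  obtain ⟨V'', hV''⟩ := exists_extends V' (AlgebraicClosure F)
  obtain ⟨y, hy, hi⟩ := (hx.algebraMap hV'').exists_isImmediate_adjoin (hV'.trans hV'')
  obtain ⟨a, ha⟩ := hV _ _ hi ⟨y, IntermediateField.mem_adjoin_simple_self K y⟩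
  exact hy.notMem_range ⟨a, congrArg Subtype.val ha⟩

theorem IsMaximal.of_finite {L : Type*} [Field L] [Algebra K L] [FiniteDimensional K L]
    {V : ValuationSubring K} {U : ValuationSubring L} (hV : IsMaximal V) (h : Extends V U) :
    IsMaximal U :=
  (hV.isSphericallyComplete.subring_of_finite (A := U.toSubring)
    fun x hx => (h.mem_iff x).2 hx).isMaximal

end Ultrapower

section Henselian

variable {R : Type*} [CommRing R]

theorem IsSphericallyComplete.exists_maximal_eval_dvd_sub (h : IsSphericallyComplete R R)
    (f : R[X]) {I : Ideal R} {a₀ : R} (ha₀ : f.eval a₀ ∈ I) :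
    ∃ a, a - a₀ ∈ I ∧ f.eval a ∈ I ∧ ∀ b, f.eval a ∣ b - a → f.eval b ∣ a - b := by
  have heval {a : R} (ha : a - a₀ ∈ I) : f.eval a ∈ I :=
    (I.sub_mem_iff_left ha₀).1 (I.mem_of_dvd (sub_dvd_eval_sub a a₀ f) ha)
  have trans {a b c : R} (hab : f.eval a ∣ b - a) (hbc : f.eval b ∣ c - b) : f.eval a ∣ c - a := by
    have : f.eval a ∣ f.eval b :=
      (dvd_sub_left dvd_rfl).1 (hab.trans (sub_dvd_eval_sub b a f))
    simpa using dvd_add (this.trans hbc) hab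
  have hchain (c : Set {a // a - a₀ ∈ I})
      (hc : IsChain (fun a b : {a // a - a₀ ∈ I} => f.eval (a : R) ∣ (b : R) - a) c) :
      ∃ b : {a // a - a₀ ∈ I}, ∀ a ∈ c, f.eval (a : R) ∣ (b : R) - a := by
    obtain rfl | ⟨a₁, ha₁⟩ := c.eq_empty_or_nonempty
    · exact ⟨⟨a₀, by simp⟩, by simp⟩
    obtain ⟨b, hb⟩ := h ((fun a : {a // a - a₀ ∈ I} => {x : R | f.eval (a : R) ∣ x - a}) '' c)
      (by
        rintro _ ⟨a, -, rfl⟩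
        exact ⟨a, Ideal.span {f.eval (a : R)}, fun x => Ideal.mem_span_singleton.symm⟩)
      (hc.symm.image_of_map_rel _ _ _ fun a b hba x hx => trans hba hx)
    have hb (a) (ha : a ∈ c) : f.eval (a : R) ∣ b - a := hb _ ⟨a, ha, rfl⟩
    refine ⟨⟨b, ?_⟩, hb⟩
    simpa using I.add_mem (I.mem_of_dvd (hb a₁ ha₁) (heval a₁.2)) a₁.2
  obtain ⟨⟨a, ha⟩, hmax⟩ := exists_maximal_of_chains_bounded hchain trans
  refine ⟨a, ha, heval ha, fun b hb => hmax ⟨b, ?_⟩ hb⟩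
  simpa using I.add_mem (I.mem_of_dvd hb (heval ha)) ha

theorem IsSphericallyComplete.henselianRing (h : IsSphericallyComplete R R) :
    HenselianRing R (Ideal.jacobson ⊥) where
  jac := le_rfl
  is_henselian f _ a₀ ha₀ hf' := by
    obtain ⟨a, ha, hfa, hmax⟩ := h.exists_maximal_eval_dvd_sub f ha₀
    refine ⟨a, ?_, ha⟩
    have hunit : IsUnit (f.derivative.eval a) := by
      have := isLocalHom_of_le_jacobson_bot (Ideal.jacobson (⊥ : Ideal R)) le_rfl
      refine isUnit_of_map_unit (Ideal.Quotient.mk (Ideal.jacobson (⊥ : Ideal R))) _ ?_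
      rwa [(Ideal.Quotient.mk_eq_mk_iff_sub_mem _ _).2
        (Ideal.mem_of_dvd _ (sub_dvd_eval_sub a a₀ _) ha)]
    obtain ⟨u, hu⟩ := hunit
    -- the Newton step
    let b := a + -(f.eval a * ↑u⁻¹)
    have hfb : f.eval a * f.eval a ∣ f.eval b := by
      obtain ⟨k, hk⟩ := f.binomExpansion a (-(f.eval a * ↑u⁻¹))
      refine ⟨k * ↑u⁻¹ ^ 2, ?_⟩
      rw [hk, ← hu]
      linear_combination (-f.eval a) * u.mul_inv
    have hsq : f.eval a * f.eval a ∣ f.eval a := hfb.trans <| by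
      simpa [b] using hmax b ⟨-↑u⁻¹, by simp [b]⟩
    obtain ⟨c, hc⟩ := hsq
    have : IsUnit (1 - f.eval a * c) := by
      simpa [sub_eq_neg_add] using Ideal.mem_jacobson_bot.1 hfa (-c)
    refine this.mul_left_cancel ?_
    linear_combination hc

theorem exists_isIdempotentElem_sub_mem {I : Ideal R} [HenselianRing R I] {e : R}
    (he : e * (1 - e) ∈ I) : ∃ i, IsIdempotentElem i ∧ i - e ∈ I := by
  have hunit : IsUnit (Ideal.Quotient.mk I (2 * e - 1)) := by
    refine IsUnit.of_mul_eq_one (Ideal.Quotient.mk I (2 * e - 1)) ?_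
    rw [← map_mul, ← map_one (Ideal.Quotient.mk I), Ideal.Quotient.mk_eq_mk_iff_sub_mem,
      show (2 * e - 1) * (2 * e - 1) - 1 = -4 * (e * (1 - e)) by ring]
    exact I.mul_mem_left _ he
  obtain ⟨i, hi, hie⟩ := HenselianRing.is_henselian (I := I) (X ^ 2 - X : R[X])
    (monic_X_pow_sub (degree_X_le.trans_lt Nat.one_lt_ofNat)) e
    (by rw [← neg_mem_iff]; simpa [mul_sub, sq] using he)
    (by simpa [one_add_one_eq_two] using hunit)
  exact ⟨i, by simpa [IsIdempotentElem, sq, sub_eq_zero] using hi, hie⟩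

variable {L : Type*} [Field L] {U₁ U₂ : ValuationSubring L}

theorem mem_jacobson_bot_of_valuation_lt_one {x : ↥(U₁.toSubring ⊓ U₂.toSubring)}
    (h₁ : U₁.valuation x < 1) (h₂ : U₂.valuation x < 1) : x ∈ Ideal.jacobson ⊥ := by
  refine Ideal.mem_jacobson_bot.2 fun y => ?_
  have hval {U : ValuationSubring L} (hx : U.valuation x < 1) (hy : (y : L) ∈ U) :
      U.valuation (x * y + 1) = 1 := by
    rw [U.valuation.map_add_eq_of_lt_right, map_one]
    rw [map_mul, map_one]
    exact mul_lt_one_of_lt_of_le hx ((U.valuation_le_one_iff _).2 hy)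
  have hval₁ := hval h₁ y.2.1
  have hmem {U : ValuationSubring L} (h : U.valuation (x * y + 1) = 1) :
      ((x : L) * y + 1)⁻¹ ∈ U := by
    rw [← U.valuation_le_one_iff, map_inv₀, h, inv_one]
  refine IsUnit.of_mul_eq_one ⟨_, hmem hval₁, hmem (hval h₂ y.2.2)⟩ (Subtype.ext ?_)
  exact mul_inv_cancel₀ (U₁.valuation.ne_zero_iff.1 (hval₁ ▸ one_ne_zero))

theorem exists_valuation_lt_one_of_not_le (h₁₂ : ¬ U₁ ≤ U₂) (h₂₁ : ¬ U₂ ≤ U₁) :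
    ∃ e ∈ U₁.toSubring ⊓ U₂.toSubring, U₁.valuation e < 1 ∧ U₂.valuation (1 - e) < 1 := by
  obtain ⟨a, ha₁, ha₂⟩ := SetLike.not_le_iff_exists.1 h₁₂
  obtain ⟨b, hb₂, hb₁⟩ := SetLike.not_le_iff_exists.1 h₂₁
  rw [← ValuationSubring.valuation_le_one_iff] at ha₁ ha₂ hb₁ hb₂
  have hab₁ := ha₁.trans_lt (not_le.1 hb₁)
  have hab₂ := hb₂.trans_lt (not_le.1 ha₂)
  have hab : a + b ≠ 0 := U₁.valuation.ne_zero_iff.1 <| by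
    rw [U₁.valuation.map_add_eq_of_lt_right hab₁]
    exact (zero_le.trans_lt hab₁).ne'
  have he₁ : U₁.valuation (a / (a + b)) < 1 := by
    rw [map_div₀, U₁.valuation.map_add_eq_of_lt_right hab₁]
    exact (div_lt_one₀ (zero_le.trans_lt hab₁)).2 hab₁
  have he₂ : U₂.valuation (1 - a / (a + b)) < 1 := by
    rw [one_sub_div hab, add_sub_cancel_left, map_div₀, U₂.valuation.map_add_eq_of_lt_left hab₂]
    exact (div_lt_one₀ (zero_le.trans_lt hab₂)).2 hab₂
  refine ⟨a / (a + b), ⟨(U₁.valuation_le_one_iff _).1 he₁.le, ?_⟩, he₁, he₂⟩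
  simpa using U₂.sub_mem U₂.one_mem ((U₂.valuation_le_one_iff _).1 he₂.le)

theorem not_isUnit_of_valuation_lt_one {A : Subring L} {U : ValuationSubring L}
    (hA : A ≤ U.toSubring) {x : A} (hx : U.valuation x < 1) : ¬ IsUnit x := fun h =>
  hx.ne ((U.valuation_eq_one_iff _).1 (h.map (Subring.inclusion hA)))

theorem le_or_le_of_henselianRing
    [HenselianRing ↥(U₁.toSubring ⊓ U₂.toSubring) (Ideal.jacobson ⊥)] : U₁ ≤ U₂ ∨ U₂ ≤ U₁ := by
  by_contra! h
  obtain ⟨e, he, he₁, he₂⟩ := exists_valuation_lt_one_of_not_le h.1 h.2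
  lift e to ↥(U₁.toSubring ⊓ U₂.toSubring) using he
  have he₁' : U₁.valuation (e * (1 - e) : L) < 1 := by
    rw [map_mul]
    exact mul_lt_one_of_lt_of_le he₁ ((U₁.valuation_le_one_iff _).2 (1 - e).2.1)
  have he₂' : U₂.valuation (e * (1 - e) : L) < 1 := by
    rw [map_mul, mul_comm]
    exact mul_lt_one_of_lt_of_le he₂ ((U₂.valuation_le_one_iff _).2 e.2.2)
  obtain ⟨i, hi, hie⟩ := exists_isIdempotentElem_sub_mem
    (mem_jacobson_bot_of_valuation_lt_one (x := e * (1 - e)) he₁' he₂')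
  obtain rfl | rfl := IsIdempotentElem.iff_eq_zero_or_one.1 hi
  · refine not_isUnit_of_valuation_lt_one inf_le_right (x := 1 - e) he₂ ?_
    simpa [sub_eq_neg_add] using Ideal.mem_jacobson_bot.1 hie 1
  · refine not_isUnit_of_valuation_lt_one inf_le_left he₁ ?_
    simpa using Ideal.mem_jacobson_bot.1 hie (-1)

end Henselian

section Algebraic

variable {K : Type u} {L : Type v} [Field K] [Field L] [Algebra K L]
  {V : ValuationSubring K} {U U₁ U₂ : ValuationSubring L}

theorem exists_valuation_pow_eq_algebraMap {Γ : Type*} [LinearOrderedCommGroupWithZero Γ]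
    (v : Valuation L Γ) {x : L} (hx : IsAlgebraic K x) :
    ∃ n ≠ 0, ∃ c : K, v (x ^ n) = v (algebraMap K L c) := by
  obtain rfl | hx0 := eq_or_ne x 0
  · exact ⟨1, one_ne_zero, 0, by simp⟩
  obtain ⟨p, hp, hpx⟩ := hx
  rw [aeval_def, eval₂_eq_sum, sum_def] at hpx
  obtain ⟨j, hj, hmax⟩ := p.support.exists_max_image
    (fun i => v (algebraMap K L (p.coeff i) * x ^ i)) (support_nonempty.2 hp)
  have hcoeff {i} (hi : i ∈ p.support) : algebraMap K L (p.coeff i) ≠ 0 := by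
    simpa using mem_support_iff.1 hi
  -- a vanishing sum cannot have a unique term of maximal value
  obtain ⟨i, hi, hij, heq⟩ : ∃ i ∈ p.support, i ≠ j ∧
      v (algebraMap K L (p.coeff i) * x ^ i) = v (algebraMap K L (p.coeff j) * x ^ j) := by
    by_contra! hne
    have hsum := v.map_sum_eq_of_lt (f := fun i => algebraMap K L (p.coeff i) * x ^ i) hj
      fun i hi => by
        rw [Finset.mem_sdiff, Finset.mem_singleton] at hi
        exact (hmax i hi.1).lt_of_ne (hne i hi.1 hi.2)
    rw [hpx, map_zero, eq_comm, map_eq_zero] at hsum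
    exact mul_ne_zero (hcoeff hj) (pow_ne_zero j hx0) hsum
  have of_lt {i j} (hj : j ∈ p.support) (hij : i < j)
      (heq : v (algebraMap K L (p.coeff i) * x ^ i) = v (algebraMap K L (p.coeff j) * x ^ j)) :
      ∃ n ≠ 0, ∃ c : K, v (x ^ n) = v (algebraMap K L c) := by
    refine ⟨j - i, Nat.sub_ne_zero_of_lt hij, p.coeff i / p.coeff j, ?_⟩
    rw [pow_sub₀ x hx0 hij.le, ← div_eq_mul_inv, map_div₀, map_div₀, map_div₀, div_eq_div_iff
      (v.ne_zero_iff.2 (pow_ne_zero i hx0)) (v.ne_zero_iff.2 (hcoeff hj)), ← map_mul, ← map_mul,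
      heq, mul_comm]
  obtain hij | hij := hij.lt_or_gt
  · exact of_lt hj hij heq
  · exact of_lt hi hij heq.symm

theorem Extends.eq_of_le [Algebra.IsAlgebraic K L] (h₁ : Extends V U₁) (h₂ : Extends V U₂)
    (hle : U₁ ≤ U₂) : U₁ = U₂ := by
  refine hle.antisymm fun x hx => by_contra fun hx₁ => ?_
  obtain ⟨n, hn, c, hc⟩ := exists_valuation_pow_eq_algebraMap U₁.valuation
    (Algebra.IsAlgebraic.isAlgebraic (R := K) x)
  have hunit : U₂.valuation (x ^ n) = U₂.valuation (algebraMap K L c) := by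
    rw [← U₁.mapOfLE_valuation_apply U₂ hle, hc, U₁.mapOfLE_valuation_apply U₂ hle]
  have hcV : c ∈ V := by
    rw [← h₂.mem_iff, ← U₂.valuation_le_one_iff, ← hunit, U₂.valuation_le_one_iff]
    exact pow_mem hx n
  rw [← h₁.mem_iff, ← U₁.valuation_le_one_iff, ← hc, map_pow, pow_le_one_iff hn,
    U₁.valuation_le_one_iff] at hcV
  exact hx₁ hcV

theorem Extends.of_isScalarTower {F : Type*} [Field F] [Algebra K F] [Algebra L F]
    [IsScalarTower K L F] {V' : ValuationSubring F} (h : Extends V V') :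
    Extends V (V'.comap (algebraMap L F)) := by
  rw [Extends, ValuationSubring.comap_comap, ← IsScalarTower.algebraMap_eq, h]

namespace IsSphericallyComplete

theorem eq_of_extends_of_finite [FiniteDimensional K L] (hV : IsSphericallyComplete V K)
    (h₁ : Extends V U₁) (h₂ : Extends V U₂) : U₁ = U₂ := by
  let A : Subring L := U₁.toSubring ⊓ U₂.toSubring
  have hA : IsSphericallyComplete A A :=
    of_injective (Algebra.linearMap A L) Subtype.val_injective <|
      hV.subring_of_finite fun x hx => ⟨(h₁.mem_iff x).2 hx, (h₂.mem_iff x).2 hx⟩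
  have := hA.henselianRing
  obtain h | h := le_or_le_of_henselianRing (U₁ := U₁) (U₂ := U₂)
  · exact h₁.eq_of_le h₂ h
  · exact (h₂.eq_of_le h₁ h).symm

theorem eq_of_extends [Algebra.IsAlgebraic K L] (hV : IsSphericallyComplete V K)
    (h₁ : Extends V U₁) (h₂ : Extends V U₂) : U₁ = U₂ := by
  ext x
  let E := IntermediateField.adjoin K {x}
  have : FiniteDimensional K E := IntermediateField.adjoin.finiteDimensional
    (Algebra.IsIntegral.isIntegral x)
  let y : E := IntermediateField.AdjoinSimple.gen K x
  have := hV.eq_of_extends_of_finite (h₁.of_isScalarTower (L := E)) (h₂.of_isScalarTower (L := E))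
  simpa [y] using SetLike.ext_iff.1 this y

theorem coeff_minpoly_mem [Normal K L] (hV : IsSphericallyComplete V K) (h : Extends V U) {x : L}
    (hx : x ∈ U) (i : ℕ) : (minpoly K x).coeff i ∈ V := by
  have hconj : ∀ y ∈ ((minpoly K x).map (algebraMap K L)).roots, y ∈ U := by
    intro y hy
    obtain ⟨σ, rfl⟩ := minpoly.exists_algEquiv_of_root' (Algebra.IsAlgebraic.isAlgebraic (R := K) x)
      (by simpa using (mem_roots'.1 hy).2)
    have hσ : Extends V (U.comap (σ : L →+* L)) := by
      rw [Extends, ValuationSubring.comap_comap, ← AlgEquiv.toAlgHom_toRingHom,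
        AlgHom.comp_algebraMap, h]
    rwa [hV.eq_of_extends h hσ] at hx
  have hlifts : (minpoly K x).map (algebraMap K L) ∈ lifts U.subtype :=
    (Normal.splits ‹_› x).mem_lift_of_roots_mem_range
      ((minpoly.monic (Algebra.IsIntegral.isIntegral x)).map _) _
      fun y hy => ⟨⟨y, hconj y hy⟩, rfl⟩
  obtain ⟨c, hc⟩ := (lifts_iff_coeff_lifts _).1 hlifts i
  rw [← h.mem_iff, ← coeff_map, ← hc]
  exact c.2

end IsSphericallyComplete

end Algebraic

section SeparablyClosed

variable {K₀ N M : Type*} [Field K₀] [Field N] [Field M] [Algebra K₀ N] [Algebra K₀ M]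
  [Algebra N M] [IsScalarTower K₀ N M]

theorem IsRelSepClosed.mem_lifts_of_dvd (h : IsRelSepClosed K₀ N) {f : K₀[X]} (hf : f.Separable)
    {g : N[X]} (hg : g.Monic) (hgf : g ∣ f.map (algebraMap K₀ N)) :
    g ∈ lifts (algebraMap K₀ N) := by
  let Ω := AlgebraicClosure N
  have hlift : g.map (algebraMap N Ω) ∈ lifts (algebraMap (separableClosure K₀ Ω) Ω) := by
    refine (IsAlgClosed.splits _).mem_lift_of_roots_mem_range (hg.map _) _ fun a ha => ?_
    have hfa : f.aeval a = 0 := by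
      rw [← aeval_map_algebraMap N]
      exact aeval_eq_zero_of_dvd_aeval_eq_zero hgf (by simpa using (mem_roots'.1 ha).2)
    exact ⟨⟨a, mem_separableClosure_iff.2 (hf.of_dvd (minpoly.dvd K₀ a hfa))⟩, rfl⟩
  rw [lifts_iff_coeff_lifts] at hlift ⊢
  intro n
  obtain ⟨s, hs⟩ := hlift n
  have hn : g.coeff n ∈ separableClosure K₀ N := by
    rw [← map_mem_separableClosure_iff (IsScalarTower.toAlgHom K₀ N Ω)]
    rw [coeff_map] at hs
    exact hs ▸ s.2
  rw [show separableClosure K₀ N = ⊥ from h] at hn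
  exact IntermediateField.mem_bot.1 hn

theorem IsRelSepClosed.map_minpoly (h : IsRelSepClosed K₀ N) {z : M} (hz : IsSeparable K₀ z) :
    (minpoly K₀ z).map (algebraMap K₀ N) = minpoly N z := by
  have hint : IsIntegral N z := hz.isIntegral.tower_top
  obtain ⟨g, hg, hdeg, hgm⟩ := lifts_and_natDegree_eq_and_monic (h.mem_lifts_of_dvd hz
    (minpoly.monic hint) (minpoly.dvd_map_of_isScalarTower K₀ N z)) (minpoly.monic hint)
  have hgz : aeval z g = 0 := by rw [← aeval_map_algebraMap N, hg, minpoly.aeval]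
  refine eq_of_monic_of_dvd_of_natDegree_le (minpoly.monic hint)
    ((minpoly.monic hz.isIntegral).map _) (minpoly.dvd_map_of_isScalarTower K₀ N z) ?_
  rw [natDegree_map, ← hdeg]
  exact natDegree_le_of_dvd (minpoly.dvd K₀ z hgz) hgm.ne_zero

theorem IsRelSepClosed.finrank_le_finSepDegree (h : IsRelSepClosed K₀ N) [FiniteDimensional N M]
    {T : Type*} [Field T] [Algebra K₀ T] [FiniteDimensional K₀ T] [Algebra.IsSeparable K₀ T]
    (φ : T →ₐ[K₀] M) : Module.finrank K₀ T ≤ Field.finSepDegree N M := by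
  obtain ⟨z, hz⟩ := Field.exists_primitive_element K₀ T
  have hsep : IsSeparable K₀ (φ z) := .map φ φ.injective (Algebra.IsSeparable.isSeparable K₀ z)
  have : Algebra.IsSeparable N (IntermediateField.adjoin N {φ z}) :=
    (IntermediateField.isSeparable_adjoin_simple_iff_isSeparable ..).2 (hsep.tower_top N)
  calc Module.finrank K₀ T = (minpoly N (φ z)).natDegree := by
        rw [← h.map_minpoly hsep, natDegree_map, minpoly.algHom_eq φ φ.injective,
          (Field.primitive_element_iff_minpoly_natDegree_eq ..).1 hz]
    _ = Field.finSepDegree N (IntermediateField.adjoin N {φ z}) := by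
        rw [Field.finSepDegree_eq_finrank_of_isSeparable,
          IntermediateField.adjoin.finrank (hsep.tower_top N).isIntegral]
    _ ≤ Field.finSepDegree N M := by
        rw [← Field.finSepDegree_mul_finSepDegree_of_isAlgebraic N
          (IntermediateField.adjoin N {φ z}) M]
        exact Nat.le_mul_of_pos_right _ (NeZero.pos _)

theorem IsRelSepClosed.finSepDegree_le (h : IsRelSepClosed K₀ N) [FiniteDimensional N M]
    {E : Type*} [Field E] [Algebra K₀ E] [FiniteDimensional K₀ E] (φ : E →ₐ[K₀] M) :
    Field.finSepDegree K₀ E ≤ Field.finSepDegree N M := by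
  rw [Field.finSepDegree_eq]
  exact h.finrank_le_finSepDegree (φ.comp (separableClosure K₀ E).val)

end SeparablyClosed

section Uniqueness

variable {K₀ K N : Type*} [Field K₀] [Field K] [Field N] [Algebra K₀ K] [Algebra K₀ N]
  {w : ValuationSubring K₀} {W W' : ValuationSubring K} {VN : ValuationSubring N}

theorem Extends.mem_of_coeff_minpoly_mem (hW : Extends w W) {x : K} (hx : IsIntegral K₀ x)
    (hc : ∀ i, (minpoly K₀ x).coeff i ∈ w) : x ∈ W := by
  obtain ⟨p, hp, -, hpm⟩ := lifts_and_natDegree_eq_and_monic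
    ((lifts_iff_coeff_lifts _).2 fun i => ⟨⟨_, hc i⟩, rfl⟩ : minpoly K₀ x ∈ lifts w.subtype)
    (minpoly.monic hx)
  have : IsIntegral W x := ⟨p.map hW.ringMap, hpm.map _, by
    have : eval₂ ((algebraMap K₀ K).comp w.subtype) x p = 0 := by
      rw [← eval₂_map, hp, ← aeval_def, minpoly.aeval]
    rwa [eval₂_map]⟩
  obtain ⟨y, rfl⟩ := IsIntegrallyClosed.isIntegral_iff.1 this
  exact y.2

theorem Extends.le_of_isSphericallyComplete [Algebra.IsAlgebraic K₀ K] (hN : Extends w VN)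
    (hVN : IsSphericallyComplete VN N) (hs : IsRelSepClosed K₀ N)
    {Ω : Type*} [Field Ω] [Algebra N Ω] [Normal N Ω] [Algebra K₀ Ω] [IsScalarTower K₀ N Ω]
    {U : ValuationSubring Ω} (hU : Extends VN U) (φ : K →ₐ[K₀] Ω) (hW : Extends w W) :
    U.comap φ.toRingHom ≤ W := by
  intro x hx
  obtain ⟨q, _⟩ := ExpChar.exists K₀
  have : ExpChar (separableClosure K₀ K) q := expChar_of_injective_algebraMap
    (algebraMap K₀ (separableClosure K₀ K)).injective q
  obtain ⟨n, y, hy⟩ := IsPurelyInseparable.pow_mem (separableClosure K₀ K) q x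
  have hsep : IsSeparable K₀ (x ^ q ^ n) := by
    rw [← mem_separableClosure_iff, ← hy]
    exact y.2
  have hpow : x ^ q ^ n ∈ W := by
    refine hW.mem_of_coeff_minpoly_mem hsep.isIntegral fun i => ?_
    rw [← hN.mem_iff, ← coeff_map, ← minpoly.algHom_eq φ φ.injective,
      hs.map_minpoly (hsep.map φ φ.injective)]
    exact hVN.coeff_minpoly_mem hU (pow_mem (S := U.comap φ.toRingHom) hx _) i
  rwa [← W.valuation_le_one_iff, map_pow, pow_le_one_iff (pow_ne_zero _ (expChar_ne_zero K₀ q)),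
    W.valuation_le_one_iff] at hpow

theorem IsRelSepClosed.eq_of_extends [Algebra.IsAlgebraic K₀ K] (hs : IsRelSepClosed K₀ N)
    (hN : Extends w VN) (hVN : IsSphericallyComplete VN N) (hW : Extends w W)
    (hW' : Extends w W') : W = W' := by
  obtain ⟨U, hU⟩ := exists_extends VN (AlgebraicClosure N)
  let φ : K →ₐ[K₀] AlgebraicClosure N := IsAlgClosed.lift
  have hφ : Extends w (U.comap φ.toRingHom) := by
    rw [Extends, ValuationSubring.comap_comap, AlgHom.toRingHom_eq_coe, φ.comp_algebraMap]
    exact hN.trans hU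
  have hle {W : ValuationSubring K} (hW : Extends w W) : U.comap φ.toRingHom = W :=
    hφ.eq_of_le hW (hN.le_of_isSphericallyComplete hVN hs hU φ hW)
  exact (hle hW).symm.trans (hle hW')

end Uniqueness

section Compositum

variable {K₀ N K M : Type*} [Field K₀] [Field N] [Field K] [Field M] [Algebra K₀ N] [Algebra K₀ K]
  [Algebra K₀ M] [Algebra N M] [Algebra K M] [IsScalarTower K₀ N M] [IsScalarTower K₀ K M]

theorem span_range_algebraMap_eq_top {ι : Type*} [Algebra.IsAlgebraic K₀ K]
    (b : Module.Basis ι K₀ K) (hM : IntermediateField.adjoin N (Set.range (algebraMap K M)) = ⊤) :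
    Submodule.span N (Set.range fun i => algebraMap K M (b i)) = ⊤ := by
  let φ := IsScalarTower.toAlgHom K₀ K M
  have halg : ∀ x ∈ Set.range (algebraMap K M), IsAlgebraic N x := by
    rintro _ ⟨x, rfl⟩
    exact ((Algebra.IsIntegral.isIntegral (R := K₀) x).map φ).tower_top.isAlgebraic
  have hspan : Subalgebra.toSubmodule φ.range =
      Submodule.span K₀ (Set.range fun i => algebraMap K M (b i)) := by
    rw [← Algebra.map_top, Subalgebra.map_toSubmodule, Algebra.top_toSubmodule, ← b.span_eq,
      Submodule.map_span, ← Set.range_comp]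
    rfl
  rw [← φ.range.adjoin_eq_span_of_eq_span N hspan, φ.coe_range]
  rw [← Algebra.top_toSubmodule, ← IntermediateField.top_toSubalgebra, ← hM]
  rw [IntermediateField.adjoin_toSubalgebra_of_isAlgebraic halg]
  rfl

theorem finiteDimensional_compositum [FiniteDimensional K₀ K]
    (hM : IntermediateField.adjoin N (Set.range (algebraMap K M)) = ⊤) :
    FiniteDimensional N M := by
  rw [FiniteDimensional, Module.finite_def,
    ← span_range_algebraMap_eq_top (Module.finBasis K₀ K) hM]
  exact Submodule.fg_span (Set.finite_range _)

theorem finSepDegree_compositum_le [FiniteDimensional K₀ K]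
    (hM : IntermediateField.adjoin N (Set.range (algebraMap K M)) = ⊤) :
    Field.finSepDegree N M ≤ Field.finSepDegree K₀ K := by
  have := finiteDimensional_compositum (K₀ := K₀) hM
  let Ω := AlgebraicClosure M
  rw [Field.finSepDegree_eq_of_isAlgClosed N M Ω, Field.finSepDegree_eq_of_isAlgClosed K₀ K Ω]
  refine Nat.card_le_card_of_injective
    (fun σ : M →ₐ[N] Ω => (σ.restrictScalars K₀).comp (IsScalarTower.toAlgHom K₀ K M))
    fun σ τ hστ => AlgHom.toLinearMap_injective <|
      LinearMap.ext_on (span_range_algebraMap_eq_top (Module.finBasis K₀ K) hM) ?_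
  rintro _ ⟨i, rfl⟩
  exact DFunLike.congr_fun hστ _

theorem IsRelSepClosed.compositum [FiniteDimensional K₀ K] (h : IsRelSepClosed K₀ N)
    (hM : IntermediateField.adjoin N (Set.range (algebraMap K M)) = ⊤) :
    IsRelSepClosed K M := by
  have := finiteDimensional_compositum (K₀ := K₀) hM
  refine eq_bot_iff.2 fun x hx => ?_
  rw [mem_separableClosure_iff] at hx
  let E := IntermediateField.adjoin K {x}
  have : FiniteDimensional K E := IntermediateField.adjoin.finiteDimensional hx.isIntegral
  have : Algebra.IsSeparable K E :=
    (IntermediateField.isSeparable_adjoin_simple_iff_isSeparable ..).2 hx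
  have : FiniteDimensional K₀ E := .trans K₀ K E
  have : IsScalarTower K₀ E M := .of_algebraMap_eq fun _ => rfl
  have hdeg : Field.finSepDegree K₀ K * Module.finrank K E ≤ Field.finSepDegree K₀ K * 1 :=
    calc Field.finSepDegree K₀ K * Module.finrank K E = Field.finSepDegree K₀ E := by
          rw [← Field.finSepDegree_eq_finrank_of_isSeparable K E,
            Field.finSepDegree_mul_finSepDegree_of_isAlgebraic]
      _ ≤ Field.finSepDegree N M := h.finSepDegree_le (IsScalarTower.toAlgHom K₀ E M)
      _ ≤ Field.finSepDegree K₀ K := finSepDegree_compositum_le hM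
      _ = Field.finSepDegree K₀ K * 1 := (mul_one _).symm
  have hrank : Module.finrank K E = 1 :=
    (Nat.le_of_mul_le_mul_left hdeg (NeZero.pos _)).antisymm Module.finrank_pos
  exact IntermediateField.finrank_eq_one_iff.1 hrank ▸
    IntermediateField.mem_adjoin_simple_self K x

end Compositum

section Coarsening

variable {K : Type u} {L : Type v} [Field K] [Field L] [Algebra K L]

theorem Extends.exists_coarsening {V w : ValuationSubring K} {V' : ValuationSubring L}
    (h : Extends V V') (hw : V ≤ w) : ∃ W : ValuationSubring L, V' ≤ W ∧ Extends w W := by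
  let v := V'.valuation
  let S : Subring L :=
    { carrier := {x | ∃ a ∈ w, v x ≤ v (algebraMap K L a)}
      zero_mem' := ⟨0, w.zero_mem, by simp⟩
      one_mem' := ⟨1, w.one_mem, by simp⟩
      add_mem' := by
        rintro x y ⟨a, ha, hx⟩ ⟨b, hb, hy⟩
        rcases le_total (v (algebraMap K L a)) (v (algebraMap K L b)) with hab | hab
        · exact ⟨b, hb, v.map_add_le (hx.trans hab) hy⟩
        · exact ⟨a, ha, v.map_add_le hx (hy.trans hab)⟩
      mul_mem' := by
        rintro x y ⟨a, ha, hx⟩ ⟨b, hb, hy⟩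
        refine ⟨a * b, mul_mem ha hb, ?_⟩
        simpa only [map_mul] using mul_le_mul' hx hy
      neg_mem' := by
        rintro x ⟨a, ha, hx⟩
        exact ⟨a, ha, by rwa [v.map_neg]⟩ }
  have hle : V'.toSubring ≤ S := fun x hx =>
    ⟨1, w.one_mem, by rw [map_one, map_one]; exact (V'.valuation_le_one_iff x).2 hx⟩
  refine ⟨V'.ofLE S hle, hle, ValuationSubring.ext _ _ fun x => ⟨?_, fun hx => ⟨x, hx, le_rfl⟩⟩⟩
  rintro ⟨a, ha, hxa⟩
  rw [← w.valuation_le_one_iff, ← V.mapOfLE_valuation_apply w hw] at ha ⊢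
  exact (V.monotone_mapOfLE w hw ((h.valuation_le_iff _ _).1 hxa)).trans ha

end Coarsening

section Independence

open IsLocalRing

theorem valuation_le_valuation_sum {R Γ ι : Type*} [Ring R] [LinearOrderedCommGroupWithZero Γ]
    (v : Valuation R Γ) [Fintype ι] {f : ι → R}
    (hf : ∀ i j, v (f i) ≠ 0 → v (f i) = v (f j) → i = j) (i : ι) : v (f i) ≤ v (∑ j, f j) := by
  classical
  obtain ⟨m, -, hm⟩ := Finset.univ.exists_max_image (fun j => v (f j)) ⟨i, Finset.mem_univ i⟩
  refine (hm i (Finset.mem_univ i)).trans ?_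
  obtain h0 | h0 := eq_or_ne (v (f m)) 0
  · exact h0 ▸ zero_le
  refine (v.map_sum_eq_of_lt (Finset.mem_univ m) fun j hj => ?_).ge
  rw [Finset.mem_sdiff, Finset.mem_singleton] at hj
  exact (hm j (Finset.mem_univ j)).lt_of_ne fun h => hj.2 (hf m j h0 h.symm).symm

variable {K₀ : Type u} {K : Type v} [Field K₀] [Field K] [Algebra K₀ K]
  {V₀ : ValuationSubring K₀} {V : ValuationSubring K} {ι : Type*} [Fintype ι]

variable (K₀) in
/-- A finite family in `K` is valuation independent over `K₀` if the value of each of its linear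
combinations is the maximum of the values of the terms. A basis with this property is usually
called a valuation basis. Families containing `0` are allowed. -/
def IsValuationIndependent (V : ValuationSubring K) (b : ι → K) : Prop :=
  ∀ (c : ι → K₀) (i : ι), V.valuation (c i • b i) ≤ V.valuation (∑ j, c j • b j)

theorem IsValuationIndependent.of_le {b : ι → K} (h : IsValuationIndependent K₀ V b)
    {W : ValuationSubring K} (hVW : V ≤ W) : IsValuationIndependent K₀ W b := by
  intro c i
  rw [← V.mapOfLE_valuation_apply W hVW, ← V.mapOfLE_valuation_apply W hVW]
  exact V.monotone_mapOfLE W hVW (h c i)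

theorem IsValuationIndependent.linearIndependent {b : ι → K} (h : IsValuationIndependent K₀ V b)
    (hb : ∀ i, b i ≠ 0) : LinearIndependent K₀ b := by
  rw [Fintype.linearIndependent_iff]
  intro c hc i
  have hi := h c i
  rw [hc, map_zero, le_zero_iff, V.valuation.zero_iff, smul_eq_zero] at hi
  exact hi.resolve_right (hb i)

theorem Extends.isValuationIndependent_of_residue (h : Extends V₀ V) {u : ι → V}
    (hu : letI := h.residueMap.toAlgebra
      LinearIndependent (ResidueField V₀) fun i => residue V (u i)) :
    IsValuationIndependent K₀ V fun i => (u i : K) := by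
  intro c i
  obtain ⟨m, -, hm⟩ := Finset.univ.exists_max_image
    (fun j => V.valuation (algebraMap K₀ K (c j))) ⟨i, Finset.mem_univ i⟩
  refine le_trans (b := V.valuation (algebraMap K₀ K (c m))) ?_ (le_of_not_gt fun hlt => ?_)
  · rw [Algebra.smul_def, map_mul]
    exact (mul_le_of_le_one_right' (V.valuation_le_one _)).trans (hm i (Finset.mem_univ i))
  have hcm : algebraMap K₀ K (c m) ≠ 0 := V.valuation.ne_zero_iff.1 (zero_le.trans_lt hlt).ne'
  have hmem (j : ι) : c j / c m ∈ V₀ := by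
    rw [← h.mem_iff, ← V.valuation_le_one_iff, map_div₀, map_div₀]
    exact div_le_one_of_le₀ (hm j (Finset.mem_univ j)) zero_le
  let d : ι → V₀ := fun j => ⟨c j / c m, hmem j⟩
  have hsum : ((∑ j, h.ringMap (d j) * u j : V) : K) =
      (algebraMap K₀ K (c m))⁻¹ * ∑ j, c j • (u j : K) := by
    rw [← V.subtype_apply, map_sum, Finset.mul_sum]
    refine Finset.sum_congr rfl fun j _ => ?_
    rw [Algebra.smul_def, ← mul_assoc, ← map_inv₀, ← map_mul, ← div_eq_inv_mul]
    rfl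
  have hres : residue V (∑ j, h.ringMap (d j) * u j) = 0 := by
    rw [residue_eq_zero_iff, V.valuation_lt_one_iff, hsum, map_mul, map_inv₀]
    exact (inv_mul_lt_one₀ (zero_le.trans_lt hlt)).2 hlt
  let := h.residueMap.toAlgebra
  have hdm := Fintype.linearIndependent_iff.1 hu (fun j => residue V₀ (d j))
    (by rw [← hres, map_sum]; simp only [map_mul, Algebra.smul_def]; rfl) m
  have hd : d m = 1 := Subtype.ext (div_self fun h0 => hcm (by rw [h0, map_zero]))
  rw [hd, map_one] at hdm
  exact one_ne_zero hdm

theorem IsValuationIndependent.exists_valuation_sum_eq {u : ι → K}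
    (h : IsValuationIndependent K₀ V u) (hu : ∀ i, V.valuation (u i) = 1) (c : ι → K₀) :
    ∃ a : K₀, V.valuation (∑ i, c i • u i) = V.valuation (algebraMap K₀ K a) := by
  cases isEmpty_or_nonempty ι with
  | inl _ => exact ⟨0, by simp⟩
  | inr _ =>
    obtain ⟨m, -, hm⟩ := Finset.univ.exists_max_image
      (fun i => V.valuation (c i • u i)) Finset.univ_nonempty
    have hsum := (V.valuation.map_sum_le hm).antisymm (h c m)
    exact ⟨c m, by rw [hsum, Algebra.smul_def, map_mul, hu, mul_one]⟩

/-- The value of a unit, as a unit of the value group with zero. -/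
noncomputable def unitValue (V : ValuationSubring K) : Kˣ →* V.ValueGroupˣ :=
  Units.map (V.valuation : K →* V.ValueGroup)

theorem unitValue_surjective (V : ValuationSubring K) : Function.Surjective (unitValue V) := by
  intro γ
  obtain ⟨x, hx⟩ := V.valuation_surjective (γ : V.ValueGroup)
  exact ⟨Units.mk0 x (V.valuation.ne_zero_iff.1 (hx ▸ γ.ne_zero)), Units.ext hx⟩

theorem mk_unitValue_eq_of_valuation_eq {a a' : K₀} {t t' : Kˣ} (ha : a ≠ 0) (ha' : a' ≠ 0)
    (h : V.valuation (algebraMap K₀ K a * t) = V.valuation (algebraMap K₀ K a' * t')) :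
    (unitValue V t : V.ValueGroupˣ ⧸ valueSubgroup K₀ V) = unitValue V t' := by
  refine QuotientGroup.eq.2 ⟨Units.mk0 a ha * (Units.mk0 a' ha')⁻¹, ?_⟩
  rw [map_mul, map_inv, mul_inv_eq_iff_eq_mul, mul_assoc, eq_inv_mul_iff_mul_eq, mul_comm,
    mul_comm (unitValue V t')]
  ext
  simpa [unitValue] using h

theorem IsValuationIndependent.mul {κ : Type*} [Fintype κ] {u : κ → K}
    (h : IsValuationIndependent K₀ V u) (hu : ∀ j, V.valuation (u j) = 1) {t : ι → Kˣ}
    (ht : Function.Injective fun i =>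
      (unitValue V (t i) : V.ValueGroupˣ ⧸ valueSubgroup K₀ V)) :
    IsValuationIndependent K₀ V fun p : ι × κ => u p.2 * t p.1 := by
  intro c p
  let s : ι → K := fun i => ∑ j, c (i, j) • u j
  have hsum : ∑ p, c p • (u p.2 * t p.1) = ∑ i, s i * t i := by
    simp only [Fintype.sum_prod_type, s, Finset.sum_mul, smul_mul_assoc]
  have hdist (i i' : ι) (h0 : V.valuation (s i * t i) ≠ 0)
      (heq : V.valuation (s i * t i) = V.valuation (s i' * t i')) : i = i' := by
    obtain ⟨a, ha⟩ := h.exists_valuation_sum_eq hu fun j => c (i, j)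
    obtain ⟨a', ha'⟩ := h.exists_valuation_sum_eq hu fun j => c (i', j)
    have hi : V.valuation (s i * t i) = V.valuation (algebraMap K₀ K a * t i) := by
      rw [map_mul, map_mul, ha]
    have hi' : V.valuation (s i' * t i') = V.valuation (algebraMap K₀ K a' * t i') := by
      rw [map_mul, map_mul, ha']
    refine ht (mk_unitValue_eq_of_valuation_eq (a := a) (a' := a') ?_ ?_
      (hi.symm.trans (heq.trans hi')))
    · rintro rfl
      simp [hi] at h0
    · rintro rfl
      simp [heq, hi'] at h0
  calc V.valuation (c p • (u p.2 * t p.1))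
      = V.valuation (c p • u p.2) * V.valuation (t p.1 : K) := by rw [← smul_mul_assoc, map_mul]
    _ ≤ V.valuation (s p.1) * V.valuation (t p.1 : K) :=
        mul_le_mul_left (h (fun j => c (p.1, j)) p.2) _
    _ = V.valuation (s p.1 * t p.1) := (map_mul ..).symm
    _ ≤ V.valuation (∑ p, c p • (u p.2 * t p.1)) :=
        hsum ▸ valuation_le_valuation_sum V.valuation hdist p.1

theorem Extends.exists_basis_isValuationIndependent [FiniteDimensional K₀ K] (h : Extends V₀ V)
    (hef : Module.finrank K₀ K = ramificationIndex K₀ V * h.inertiaDegree) :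
    ∃ (ι : Type v) (_ : Fintype ι) (b : Module.Basis ι K₀ K), IsValuationIndependent K₀ V b := by
  have hpos : 0 < ramificationIndex K₀ V * h.inertiaDegree := hef ▸ Module.finrank_pos
  let := h.residueMap.toAlgebra
  have : Module.Finite (ResidueField V₀) (ResidueField V) :=
    Module.finite_of_finrank_pos (Nat.pos_of_mul_pos_left hpos)
  let Q := V.ValueGroupˣ ⧸ valueSubgroup K₀ V
  have : (valueSubgroup K₀ V).FiniteIndex := ⟨(Nat.pos_of_mul_pos_right hpos).ne'⟩
  let : Fintype Q := Fintype.ofFinite Q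
  let κ := Module.finBasis (ResidueField V₀) (ResidueField V)
  choose u hu using fun j => residue_surjective (κ j)
  choose t ht using (QuotientGroup.mk_surjective (s := valueSubgroup K₀ V)).comp
    (unitValue_surjective V)
  have hu1 (j) : V.valuation (u j : K) = 1 := by
    rw [← V.valuation_eq_one_iff, ← residue_ne_zero_iff_isUnit, hu]
    exact κ.ne_zero j
  have hb : IsValuationIndependent K₀ V fun p : Q × Fin h.inertiaDegree => (u p.2 : K) * t p.1 :=
    (h.isValuationIndependent_of_residue (by simpa only [hu] using κ.linearIndependent)).mul hu1
      (Function.LeftInverse.injective (g := id) ht)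
  have hli := hb.linearIndependent fun p =>
    mul_ne_zero (V.valuation.ne_zero_iff.1 ((hu1 p.2).trans_ne one_ne_zero)) (t p.1).ne_zero
  have hcard : Fintype.card (Q × Fin h.inertiaDegree) = Module.finrank K₀ K := by
    rw [hef, Fintype.card_prod, ← Nat.card_eq_fintype_card, Fintype.card_fin]
    rfl
  have : Nonempty (Q × Fin h.inertiaDegree) :=
    ⟨1, 0, Nat.pos_of_mul_pos_left hpos⟩
  exact ⟨_, inferInstance, basisOfLinearIndependentOfCardEqFinrank hli hcard, by
    rwa [coe_basisOfLinearIndependentOfCardEqFinrank]⟩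

end Independence

section ImmediateCompositum

variable {K₀ N K M : Type*} [Field K₀] [Field N] [Field K] [Field M] [Algebra K₀ N] [Algebra K₀ K]
  [Algebra K₀ M] [Algebra N M] [Algebra K M] [IsScalarTower K₀ N M] [IsScalarTower K₀ K M]
  {w : ValuationSubring K₀} {VN : ValuationSubring N} {W : ValuationSubring K}
  {U : ValuationSubring M} {ι : Type*} [Fintype ι]

theorem IsValuationIndependent.approximates_sum {b : ι → K} (hb : IsValuationIndependent K₀ W b)
    (hN : Extends VN U) (hW : Extends W U) {a : ι → K₀} {c : ι → N}
    (hac : ∀ i, algebraMap K₀ N (a i) = c i ∨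
      Approximates VN.valuation (algebraMap K₀ N (a i)) (c i))
    (hc : ∑ i, c i • algebraMap K M (b i) ≠ 0) :
    Approximates U.valuation (algebraMap K M (∑ i, a i • b i))
      (∑ i, c i • algebraMap K M (b i)) := by
  have hterm (i : ι) : algebraMap K M (a i • b i) =
      algebraMap N M (algebraMap K₀ N (a i)) * algebraMap K M (b i) := by
    rw [Algebra.smul_def, map_mul, ← IsScalarTower.algebraMap_apply,
      ← IsScalarTower.algebraMap_apply]
  rw [map_sum]
  refine .sum (fun i => ?_) (fun i => ?_) (by simpa using hc)
  · rw [hterm, Algebra.smul_def]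
    obtain hi | hi := hac i
    · exact .inl (by rw [hi])
    obtain h0 | h0 := eq_or_ne (algebraMap K M (b i)) 0
    · exact .inl (by rw [h0, mul_zero, mul_zero])
    right
    rw [Approximates, ← sub_mul, ← map_sub, map_mul, map_mul]
    exact mul_lt_mul_of_pos_right ((hN.valuation_lt_iff _ _).2 hi) (by simpa [zero_lt_iff] using h0)
  · rw [← map_sum]
    exact (hW.valuation_le_iff _ _).2 (hb a i)

theorem IsImmediate.compositum (h : IsImmediate w VN) (hN : Extends VN U) (hW : Extends W U)
    [Algebra.IsAlgebraic K₀ K] {b : Module.Basis ι K₀ K} (hb : IsValuationIndependent K₀ W b)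
    (hM : IntermediateField.adjoin N (Set.range (algebraMap K M)) = ⊤) : IsImmediate W U := by
  refine isImmediate_of_exists_approximates hW fun z hz => ?_
  obtain ⟨c, rfl⟩ := (Submodule.mem_span_range_iff_exists_fun N).1
    (span_range_algebraMap_eq_top b hM ▸ Submodule.mem_top (x := z))
  choose a ha using fun i => show ∃ a : K₀, algebraMap K₀ N a = c i ∨
      Approximates VN.valuation (algebraMap K₀ N a) (c i) by
    obtain hi | hi := eq_or_ne (c i) 0
    · exact ⟨0, .inl (by rw [hi, map_zero])⟩
    · exact (h.exists_approximates hi).imp fun _ => .inr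
  exact ⟨_, hb.approximates_sum hN hW ha hz⟩

end ImmediateCompositum

theorem IsDefectless.finrank_eq {K : Type u} {L : Type v} [Field K] [Field L] [Algebra K L]
    {V : ValuationSubring K} {V' : ValuationSubring L} (hdl : IsDefectless L V) (h : Extends V V')
    (hunique : ∀ U, Extends V U → U = V') :
    Module.finrank K L = ramificationIndex K V' * h.inertiaDegree := by
  let : Unique {U : ValuationSubring L // Extends V U} :=
    ⟨⟨⟨V', h⟩⟩, fun U => Subtype.ext (hunique U U.2)⟩
  rw [hdl.2, finsum_unique]
  rfl

end ValuedFieldExt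

open ValuedFieldExt in
/-- `N w` is the given maximal immediate extension for the coarsening `w` of `v` (valuations are
given by their rings, so coarsenings of `V₀` are the valuation rings containing `V₀`), with
valuation ring `VN w`.  `M` runs over the composita of `N w` and `K` over `K₀`. -/
theorem lemma3p1 {K₀ : Type*} [Field K₀] (V₀ : ValuationSubring K₀)
    (N : Set.Ici V₀ → Type*) [∀ w, Field (N w)] [∀ w, Algebra K₀ (N w)]
    (VN : ∀ w, ValuationSubring (N w))
    (hN : ∀ w, ValuedFieldExt.IsMaximalImmediate w.1 (VN w))
    (hNsep : ∀ w, ValuedFieldExt.IsRelSepClosed K₀ (N w))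
    {K : Type*} [Field K] [Algebra K₀ K] (V : ValuationSubring K)
    (hV : ValuedFieldExt.Extends V₀ V)
    (hdl : ValuedFieldExt.IsDefectless K V₀) :
    ∀ w : Set.Ici V₀,
      -- `w` extends uniquely to a coarsening `W` of the valuation of `K`
      ∃ W : ValuationSubring K,
        (V ≤ W ∧ ValuedFieldExt.Extends w.1 W) ∧
        (∀ W' : ValuationSubring K, V ≤ W' → ValuedFieldExt.Extends w.1 W' → W' = W) ∧
        ∀ (M : Type*) [Field M] [Algebra K₀ M] [Algebra (N w) M] [Algebra K M]
          [IsScalarTower K₀ (N w) M] [IsScalarTower K₀ K M],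
          IntermediateField.adjoin (N w) (Set.range (algebraMap K M)) = ⊤ →
          -- the valuation of `N w` extends uniquely to `M`
          ∃ U : ValuationSubring M,
            ValuedFieldExt.Extends (VN w) U ∧
            (∀ U' : ValuationSubring M, ValuedFieldExt.Extends (VN w) U' → U' = U) ∧
            ValuedFieldExt.IsMaximalImmediate W U ∧
            ValuedFieldExt.IsRelSepClosed K M := by
  intro w
  have := hdl.1
  have hunique (w : Set.Ici V₀) {W W' : ValuationSubring K} (hW : Extends w.1 W)
      (hW' : Extends w.1 W') : W' = W :=
    (hNsep w).eq_of_extends (hN w).1.1 (hN w).2.isSphericallyComplete hW' hW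
  obtain ⟨ι, _, b, hb⟩ := hV.exists_basis_isValuationIndependent
    (hdl.finrank_eq hV fun _ => hunique ⟨V₀, Set.self_mem_Ici⟩ hV)
  obtain ⟨W, hVW, hW⟩ := hV.exists_coarsening w.2
  refine ⟨W, ⟨hVW, hW⟩, fun W' _ => hunique w hW, fun M _ _ _ _ _ _ hM => ?_⟩
  have := finiteDimensional_compositum (K₀ := K₀) hM
  obtain ⟨U, hU⟩ := exists_extends (VN w) M
  have hWU : Extends W U := hunique w hW ((hN w).1.1.trans hU).of_isScalarTower
  exact ⟨U, hU, fun U' hU' => (hN w).2.isSphericallyComplete.eq_of_extends hU' hU,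
    ⟨(hN w).1.compositum hU hWU (hb.of_le hVW) hM, (hN w).2.of_finite hU⟩,
    (hNsep w).compositum hM⟩
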